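/- Let $\mathrm{Cat}$ be the category of small categories, $t:1\to 2$ the codomain of the arrow category, and $(\mathcal E,\mathcal M)$ the comprehensive factorization system: $\mathcal M$ is the class of functors $m$ such that every commutative square from $t$ to $m$ has a unique diagonal (the discrete fibrations), and $\mathcal E$ is the class of functors $e$ such that every commutative square from $e$ to a functor in $\mathcal M$ has a unique diagonal (the final functors). Fix, for every functor, a factorization as a functor in $\mathcal E$ followed by one in $\mathcal M$. It yields for every $p:P\to X$ a reflection $p\to{\downarrow}p$ of $p$ in the full subcategory $\mathcal M/X$ of $\mathrm{Cat}/X$. For an object $x:1\to X$ let $\nu(x)={\downarrow}x$; canonically $\nu(x)\cong X/x$ over $X$. A cone with base $p$ and vertex $x$ is a map $\lambda:p\to\nu(x)$ over $X$; via $\nu(x)\cong X/x$ it is the same as a usual cone $(\lambda_a:pa\to x)_{a\in P}$. Its kernel cone is the unique map $\lambda':{\downarrow}p\to\nu(x)$ over $X$ whose composite with $p\to{\downarrow}p$ is $\lambda$. A cone $\lambda:p\to\nu(x)$ is colimiting if every cone $p\to\nu(y)$ factors through $\lambda$ by a unique map $\nu(x)\to\nu(y)$ over $X$. For $f:X\to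 Y$ and $m$ over $X$ let $\exists_f m={\downarrow}(f\circ m)$, with the canonical isomorphisms $\exists_f{\downarrow}p\cong{\downarrow}(f\circ p)$ and $\exists_f\nu(x)\cong\nu(fx)$. The direct image of a cone $\lambda:m\to\nu(x)$ with $m\in\mathcal M$ is the cone $\exists_f\lambda:\exists_f m\to\exists_f\nu(x)\cong\nu(fx)$, and $f$ preserves a colimiting cone $\lambda:m\to\nu(x)$ with $m\in\mathcal M$ if $\exists_f\lambda$ is colimiting. A functor $f$ is colimit preserving in the $(\mathcal E,\mathcal M)$ sense if it preserves all the colimiting cones whose base is in $\mathcal M$. Then, for every choice of the factorizations: 1. For all functors $p:P\to X$ and $f:X\to Y$ between small categories and every cone $\lambda:p\to\nu(x)$, the kernel cone ${\downarrow}(f\circ p)\to\nu(fx)$ of the classical image cone $(f\lambda_a:fpa\to fx)_{a\in P}$ is, up to the canonical isomorphism $\exists_f{\downarrow}p\cong{\downarrow}(f\circ p)$, the direct image $\exists_f\lambda'$ of the kernel cone $\lambda'$ of $\lambda$. 2. If moreover $\lambda$ is a colimiting cone in the classical sense, then $\lambda'$ is colimiting, and $f$ preserves $\lambda$ in the classical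 sense (that is, $(f\lambda_a)_{a\in P}$ is a colimiting cone in the classical sense) if and only if $f$ preserves $\lambda'$ in the above sense. 3. A functor $f:X\to Y$ between small categories is colimit preserving in the $(\mathcal E,\mathcal M)$ sense if and only if it preserves, in the classical sense, all the colimits of small diagrams that exist in $X$. -/

import Mathlib

open CategoryTheory CategoryTheory.Limits

universe v u

noncomputable section

namespace EMTheory

/-! ### Categories with a factorization system -/

section General

variable {C : Type u} [Category.{v} C]

/-- `e ⊥ m`: every commutative square from `e` to `m` has a unique diagonal. -/
def Orthogonal {A X B Y : C} (e : A ⟶ X) (m : B ⟶ Y) : Prop :=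
  ∀ (f : A ⟶ B) (g : X ⟶ Y), f ≫ m = e ≫ g → ∃! d : X ⟶ B, e ≫ d = f ∧ d ≫ m = g

theorem Orthogonal.comp {A X Z B Y : C} {e : A ⟶ X} {e' : X ⟶ Z} {m : B ⟶ Y}
    (h : Orthogonal e m) (h' : Orthogonal e' m) : Orthogonal (e ≫ e') m := by
  intro f g w
  obtain ⟨d, ⟨h1, h2⟩, h3⟩ := h f (e' ≫ g) (by simpa using w)
  obtain ⟨d', ⟨h1', h2'⟩, h3'⟩ := h' d g h2
  refine ⟨d', ⟨by simp [h1', h1], h2'⟩, ?_⟩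
  rintro d'' ⟨k1, k2⟩
  exact h3' d'' ⟨h3 _ ⟨by simpa using k1, by simp [k2]⟩, k2⟩

end General

/-- An `(E, M)`-category: a finitely complete category with a factorization system on it,
a chosen factorization of every map (equivalently, a chosen reflection of every space over `X`
in the discrete spaces over `X`), and a chosen terminal object. -/
structure EMCategory (C : Type u) [Category.{v} C] [HasFiniteLimits C] where
  /-- the final maps -/
  E : MorphismProperty C
  /-- the discrete maps -/
  M : MorphismProperty C
  E_iff : ∀ {A X : C} (e : A ⟶ X), E e ↔ ∀ {B Y : C} (m : B ⟶ Y), M m → Orthogonal e m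
  M_iff : ∀ {B Y : C} (m : B ⟶ Y), M m ↔ ∀ {A X : C} (e : A ⟶ X), E e → Orthogonal e m
  /-- the chosen factorizations -/
  fac : MorphismProperty.FactorizationData E M
  /-- the terminal object `1` -/
  one : C
  isTerminalOne : IsTerminal one

namespace EMCategory

variable {C : Type u} [Category.{v} C] [HasFiniteLimits C] (S : EMCategory C)

/-- A space `m` over `X` is discrete if its structure map is in `M`. -/
def IsDiscrete {X : C} (m : Over X) : Prop := S.M m.hom

/-- The discrete reflection `↓ p` of a space `p` over `X`. -/
def down {X : C} (p : Over X) : Over X := Over.mk (S.fac p.hom).p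

/-- The reflection map `p ⟶ ↓ p`. -/
def unit {X : C} (p : Over X) : p ⟶ S.down p := Over.homMk (S.fac p.hom).i (S.fac p.hom).fac

theorem E_unit {X : C} (p : Over X) : S.E (S.unit p).left := (S.fac p.hom).hi

theorem isDiscrete_down {X : C} (p : Over X) : S.IsDiscrete (S.down p) := (S.fac p.hom).hp

theorem existsUnique_extend {X : C} {p q n : Over X} (e : p ⟶ q) (he : S.E e.left)
    (hn : S.IsDiscrete n) (g : p ⟶ n) : ∃! d : q ⟶ n, e ≫ d = g := by
  obtain ⟨d, ⟨h1, h2⟩, h3⟩ := (S.E_iff _).1 he n.hom hn g.left q.hom (by simp)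
  refine ⟨Over.homMk d h2, by ext; simpa using h1, fun d' h => ?_⟩
  ext
  simpa using h3 d'.left ⟨by simp [← h], by simp⟩

/-- The extension along `e` in `E` of a map over `X` to a discrete space. -/
def extend {X : C} {p q n : Over X} (e : p ⟶ q) (he : S.E e.left)
    (hn : S.IsDiscrete n) (g : p ⟶ n) : q ⟶ n :=
  (S.existsUnique_extend e he hn g).choose

theorem extend_fac {X : C} {p q n : Over X} (e : p ⟶ q) (he : S.E e.left)
    (hn : S.IsDiscrete n) (g : p ⟶ n) : e ≫ S.extend e he hn g = g :=
  (S.existsUnique_extend e he hn g).choose_spec.1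

theorem extend_hom_ext {X : C} {p q n : Over X} (e : p ⟶ q) (he : S.E e.left)
    (hn : S.IsDiscrete n) {d d' : q ⟶ n} (h : e ≫ d = e ≫ d') : d = d' :=
  (S.existsUnique_extend e he hn (e ≫ d')).unique h rfl

/-- The map `↓ p ⟶ n` that corresponds to a map `p ⟶ n` to a discrete space `n`. -/
def desc {X : C} {p n : Over X} (hn : S.IsDiscrete n) (g : p ⟶ n) : S.down p ⟶ n :=
  S.extend (S.unit p) (S.E_unit p) hn g

/-- The action of `↓` on maps over `X`. -/
def downMap {X : C} {p q : Over X} (φ : p ⟶ q) : S.down p ⟶ S.down q :=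
  S.desc (S.isDiscrete_down q) (φ ≫ S.unit q)

/-- The canonical isomorphism `↓ p ≅ m` for a factorization `p ⟶ m` of `p` with `m` discrete. -/
def downIso {X : C} {p m : Over X} (e : p ⟶ m) (he : S.E e.left) (hm : S.IsDiscrete m) :
    S.down p ≅ m where
  hom := S.desc hm e
  inv := S.extend e he (S.isDiscrete_down p) (S.unit p)
  hom_inv_id := S.extend_hom_ext (S.unit p) (S.E_unit p) (S.isDiscrete_down p) (by
    rw [desc, ← Category.assoc, extend_fac, extend_fac, Category.comp_id])
  inv_hom_id := S.extend_hom_ext e he hm (by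
    rw [desc, ← Category.assoc, extend_fac, extend_fac, Category.comp_id])

/-- The neighborhood `ν(x) = ↓ x` of a point `x : 1 ⟶ X`. -/
abbrev nbhd {X : C} (x : S.one ⟶ X) : Over X := S.down (Over.mk x)

theorem isDiscrete_nbhd {X : C} (x : S.one ⟶ X) : S.IsDiscrete (S.nbhd x) :=
  S.isDiscrete_down _

/-- A cone with base `p` and vertex `x` is a map `p ⟶ ν(x)` over `X`. -/
abbrev Cone {X : C} (p : Over X) (x : S.one ⟶ X) : Type v := p ⟶ S.nbhd x

/-- The kernel cone `↓ p ⟶ ν(x)` of a cone `c : p ⟶ ν(x)`. -/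
def kernel {X : C} {p : Over X} {x : S.one ⟶ X} (c : S.Cone p x) : S.Cone (S.down p) x :=
  S.desc (S.isDiscrete_nbhd x) c

/-- A cone `p ⟶ ν(x)` is colimiting if it is a reflection of `p` in the full subcategory
of the spaces over `X` given by the neighborhoods of the points of `X`. -/
def IsColimiting {X : C} {p : Over X} {x : S.one ⟶ X} (c : S.Cone p x) : Prop :=
  ∀ (y : S.one ⟶ X) (d : S.Cone p y), ∃! k : S.nbhd x ⟶ S.nbhd y, c ≫ k = d

/-- The direct image `∃_f m = ↓ (f ∘ m)`. -/
abbrev directImage {X Y : C} (f : X ⟶ Y) (m : Over X) : Over Y := S.down ((Over.map f).obj m)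

/-- The action of the direct image on maps over `X`. -/
def directImageMap {X Y : C} (f : X ⟶ Y) {m n : Over X} (φ : m ⟶ n) :
    S.directImage f m ⟶ S.directImage f n :=
  S.downMap ((Over.map f).map φ)

/-- The canonical isomorphism `∃_f (↓ p) ≅ ↓ (f ∘ p)`. It is the isomorphism under the
space `f ∘ p`. -/
def directImageDownIso {X Y : C} (f : X ⟶ Y) (p : Over X) :
    S.directImage f (S.down p) ≅ S.down ((Over.map f).obj p) :=
  (S.downIso ((Over.map f).map (S.unit p) ≫ S.unit ((Over.map f).obj (S.down p)))
    ((S.E_iff _).2 fun m hm => ((S.E_iff _).1 (S.E_unit p) m hm).comp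
      ((S.E_iff _).1 (S.E_unit ((Over.map f).obj (S.down p))) m hm))
    (S.isDiscrete_down _)).symm

/-- The canonical isomorphism `∃_f ν(x) ≅ ν(f x)`. -/
def directImageNbhdIso {X Y : C} (f : X ⟶ Y) (x : S.one ⟶ X) :
    S.directImage f (S.nbhd x) ≅ S.nbhd (x ≫ f) :=
  S.directImageDownIso f (Over.mk x)

/-- The image cone `∃_f c : ∃_f m ⟶ ∃_f ν(x) ≅ ν(f x)` of a cone `c : m ⟶ ν(x)`. -/
def imageCone {X Y : C} (f : X ⟶ Y) {m : Over X} {x : S.one ⟶ X} (c : S.Cone m x) :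
    S.Cone (S.directImage f m) (x ≫ f) :=
  S.directImageMap f c ≫ (S.directImageNbhdIso f x).hom

/-- `f` preserves the (colimiting) cone `c` if its image cone is colimiting. -/
def PreservesCone {X Y : C} (f : X ⟶ Y) {m : Over X} {x : S.one ⟶ X} (c : S.Cone m x) : Prop :=
  S.IsColimiting (S.imageCone f c)

/-- `f` is colimit preserving if it preserves all the colimiting cones with a discrete base. -/
def ColimitPreserving {X Y : C} (f : X ⟶ Y) : Prop :=
  ∀ (m : Over X), S.IsDiscrete m → ∀ (x : S.one ⟶ X) (c : S.Cone m x),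
    S.IsColimiting c → S.PreservesCone f c

end EMCategory

/-! ### Discrete fibrations and final functors -/

/-- `n` is a discrete fibration: every arrow `h : y ⟶ n b` has a unique lift with codomain `b`. -/
structure IsDiscreteFibration {A B : Type u} [Category.{u} A] [Category.{u} B] (n : A ⥤ B) :
    Prop where
  lift : ∀ (b : A) {y : B} (h : y ⟶ n.obj b),
    ∃ (a : A) (k : a ⟶ b) (w : n.obj a = y), n.map k = eqToHom w ≫ h
  uniq : ∀ {b a a' : A} (k : a ⟶ b) (k' : a' ⟶ b) (w : n.obj a = n.obj a'),
    n.map k = eqToHom w ≫ n.map k' → ∃ w' : a = a', k = eqToHom w' ≫ k'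

namespace IsDiscreteFibration

theorem faithful {A B : Type u} [Category.{u} A] [Category.{u} B] {n : A ⥤ B}
    (hn : IsDiscreteFibration n) {a b : A} {k k' : a ⟶ b} (h : n.map k = n.map k') : k = k' := by
  obtain ⟨w, hw⟩ := hn.uniq k k' rfl (by simpa using h)
  simpa using hw

/-- Final functors are orthogonal to discrete fibrations. -/
theorem diagonal {P Q A B : Type u} [Category.{u} P] [Category.{u} Q] [Category.{u} A]
    [Category.{u} B] (e : P ⥤ Q) [e.Final] {n : A ⥤ B} (hn : IsDiscreteFibration n)
    (f : P ⥤ A) (g : Q ⥤ B) (h : f ⋙ n = e ⋙ g) :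
    ∃! d : Q ⥤ A, e ⋙ d = f ∧ d ⋙ n = g := by
  have ho : ∀ a, g.obj (e.obj a) = n.obj (f.obj a) := fun a => (Functor.congr_obj h a).symm
  have hm : ∀ {a a' : P} (m : a ⟶ a'), n.map (f.map m) =
      eqToHom (ho a).symm ≫ g.map (e.map m) ≫ eqToHom (ho a') :=
    fun m => Functor.congr_hom h m
  have key : ∀ q : Q, ∃ (z : A) (w : n.obj z = g.obj q), ∀ (a : P) (k : q ⟶ e.obj a),
      ∃ l : z ⟶ f.obj a, n.map l = eqToHom w ≫ g.map k ≫ eqToHom (ho a) := by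
    intro q
    obtain ⟨z, l, w, hl⟩ := hn.lift (f.obj (Functor.Final.lift e q))
      (g.map (Functor.Final.homToLift e q) ≫ eqToHom (ho _))
    refine ⟨z, w, fun a k => ?_⟩
    refine (isPreconnected_induction
      (Z := fun s : StructuredArrow q e => ∃ l : z ⟶ f.obj s.right,
        n.map l = eqToHom w ≫ g.map s.hom ≫ eqToHom (ho _)) ?_ ?_
      (j₀ := StructuredArrow.mk (Functor.Final.homToLift e q)) ⟨l, hl⟩ (StructuredArrow.mk k)).some
    · rintro s s' φ ⟨l, hl⟩
      refine ⟨l ≫ f.map φ.right, ?_⟩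
      have h2 := congrArg g.map (StructuredArrow.w φ)
      rw [g.map_comp] at h2
      simp [hl, hm, ← h2]
    · rintro s s' φ ⟨l, hl⟩
      obtain ⟨z', l', w', hl'⟩ := hn.lift (f.obj s.right) (g.map s.hom ≫ eqToHom (ho _))
      obtain ⟨rfl, -⟩ := hn.uniq (l' ≫ f.map φ.right) l (w'.trans w.symm) (by
        have h2 := congrArg g.map (StructuredArrow.w φ)
        rw [g.map_comp] at h2
        simp [hl, hl', hm, ← h2])
      exact ⟨l', hl'⟩
  choose z w l hl using key
  have hk : ∀ (q q' : Q) (k : q ⟶ q'), ∃ m : z q ⟶ z q',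
      n.map m = eqToHom (w q) ≫ g.map k ≫ eqToHom (w q').symm := by
    intro q q' k
    obtain ⟨y, m, v, hv⟩ := hn.lift (z q') (g.map k ≫ eqToHom (w q').symm)
    have := hl q' _ (Functor.Final.homToLift e q')
    obtain ⟨rfl, -⟩ := hn.uniq (m ≫ l q' _ (Functor.Final.homToLift e q'))
      (l q _ (k ≫ Functor.Final.homToLift e q')) (v.trans (w q).symm) (by simp [hl, hv])
    exact ⟨m, hv⟩
  choose m hm' using hk
  let d : Q ⥤ A :=
    { obj := z
      map := fun {q q'} k => m q q' k
      map_id := fun q => hn.faithful (by simp [hm'])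
      map_comp := fun k k' => hn.faithful (by simp [hm']) }
  have hdn : d ⋙ n = g := CategoryTheory.Functor.ext w (fun q q' k => hm' q q' k)
  have hoe : ∀ p, z (e.obj p) = f.obj p := fun p =>
    (hn.uniq (l (e.obj p) p (𝟙 _)) (𝟙 _) ((w _).trans (ho p)) (by simp [hl])).1
  refine ⟨d, ⟨CategoryTheory.Functor.ext hoe fun p p' k => hn.faithful ?_, hdn⟩, ?_⟩
  · change n.map (m _ _ (e.map k)) = _
    simp [hm', hm, eqToHom_map]
  · rintro d' ⟨h1, h2⟩
    have ho' : ∀ q, d'.obj q = z q := fun q => by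
      have h3 := Functor.congr_obj h1 (Functor.Final.lift e q)
      refine (hn.uniq (d'.map (Functor.Final.homToLift e q) ≫ eqToHom h3)
        (l q _ (Functor.Final.homToLift e q))
        ((Functor.congr_obj h2 q).trans (w q).symm) ?_).1
      have h4 := Functor.congr_hom h2 (Functor.Final.homToLift e q)
      simp only [Functor.comp_map] at h4
      simp [hl, h4, eqToHom_map]
    refine CategoryTheory.Functor.ext ho' fun q q' k => hn.faithful ?_
    have h4 := Functor.congr_hom h2 k
    simp only [Functor.comp_map] at h4
    change _ = n.map (eqToHom _ ≫ m q q' k ≫ eqToHom _)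
    simp [hm', h4, eqToHom_map]

end IsDiscreteFibration

section Reflection
variable {P X : Type u} [Category.{u} P] [Category.{u} X] (p : P ⥤ X)

/-- Objects of the total category of the discrete reflection of `p`: an object `x` with a
connected component of the category `x / p`. -/
structure DownSet where
  pt : X
  comp : ConnectedComponents (StructuredArrow pt p)

namespace DownSet
variable {p}

/-- restriction of components along `k : x ⟶ y`. -/
def res {x y : X} (k : x ⟶ y) (c : ConnectedComponents (StructuredArrow y p)) :
    ConnectedComponents (StructuredArrow x p) :=
  (StructuredArrow.map k).mapConnectedComponents c

theorem res_mk {x y : X} (k : x ⟶ y) (s : StructuredArrow y p) :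
    res k (Quotient.mk _ s) = Quotient.mk _ (StructuredArrow.mk (k ≫ s.hom)) := rfl

theorem res_id {x : X} (c : ConnectedComponents (StructuredArrow x p)) : res (𝟙 x) c = c := by
  induction c using Quotient.inductionOn with
  | h c => rw [res_mk, Category.id_comp]; rfl

theorem res_res {x y z : X} (k : x ⟶ y) (l : y ⟶ z)
    (c : ConnectedComponents (StructuredArrow z p)) : res k (res l c) = res (k ≫ l) c := by
  induction c using Quotient.inductionOn with
  | h c => rw [res_mk, res_mk, res_mk, Category.assoc]; rfl

instance : Category.{u} (DownSet p) where
  Hom s t := { k : s.pt ⟶ t.pt // res k t.comp = s.comp }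
  id s := ⟨𝟙 _, res_id _⟩
  comp k l := ⟨k.1 ≫ l.1, by rw [← res_res, l.2, k.2]⟩

variable (p)

/-- The projection to the base. -/
def proj : DownSet p ⥤ X where
  obj s := s.pt
  map k := k.1

/-- The reflection map. -/
def unit : P ⥤ DownSet p where
  obj a := ⟨p.obj a, Quotient.mk _ (StructuredArrow.mk (𝟙 _))⟩
  map {a b} m := ⟨p.map m, by
    rw [res_mk]
    refine Quotient.sound (Zigzag.symm (Zigzag.of_hom ?_))
    exact StructuredArrow.homMk m (by simp)⟩

theorem isDiscreteFibration_proj : IsDiscreteFibration (proj p) where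
  lift b y h := ⟨⟨y, res h b.comp⟩, ⟨h, rfl⟩, rfl, (Category.id_comp h).symm⟩
  uniq {b a a'} k k' w hw := by
    obtain ⟨x, c⟩ := a
    obtain ⟨x', c'⟩ := a'
    obtain ⟨k, hk⟩ := k
    obtain ⟨k', hk'⟩ := k'
    obtain rfl : x = x' := w
    obtain rfl : k = k' := hw.trans (Category.id_comp _)
    obtain rfl : c = c' := hk.symm.trans hk'
    exact ⟨rfl, (Category.id_comp (X := (⟨x, c⟩ : DownSet p)) _).symm⟩

theorem final_unit : (unit p).Final where
  out := by
    rintro ⟨x, c₀⟩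
    have hres : ∀ s : StructuredArrow x p,
        res s.hom (((unit p).obj s.right).comp) = Quotient.mk _ s := fun s => by
      change Quotient.mk _ (StructuredArrow.mk (s.hom ≫ 𝟙 _)) = _
      rw [Category.comp_id]; rfl
    let F : ∀ s : StructuredArrow x p, Quotient.mk (Zigzag.setoid _) s = c₀ →
        StructuredArrow (⟨x, c₀⟩ : DownSet p) (unit p) := fun s hs =>
      StructuredArrow.mk (Y := s.right) ⟨s.hom, (hres s).trans hs⟩
    have hF : ∀ t, ∃ s hs, F s hs = t := fun t =>
      ⟨StructuredArrow.mk t.hom.1, (hres (StructuredArrow.mk t.hom.1)).symm.trans t.hom.2, rfl⟩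
    have hF' : ∀ {s s' : StructuredArrow x p} (hs hs') (φ : s ⟶ s'),
        Nonempty (F s hs ⟶ F s' hs') := fun hs hs' φ =>
      ⟨StructuredArrow.homMk φ.right (Subtype.ext (StructuredArrow.w φ))⟩
    have hz : ∀ s s' : StructuredArrow x p, Zigzag s s' → ∀ hs hs',
        Zigzag (F s hs) (F s' hs') := by
      intro s s' h
      induction h with
      | refl => exact fun _ _ => Zigzag.refl _
      | @tail a b h1 h2 ih =>
        intro hs hs'
        have ha : Quotient.mk (Zigzag.setoid _) a = c₀ :=
          (Quotient.sound (Zigzag.symm h1)).trans hs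
        refine (ih hs ha).trans ?_
        rcases h2 with ⟨⟨φ⟩⟩ | ⟨⟨φ⟩⟩
        · exact Zigzag.of_hom (hF' ha hs' φ).some
        · exact Zigzag.of_inv (hF' hs' ha φ).some
    obtain ⟨s₀, hs₀⟩ := Quotient.exists_rep c₀
    have : Nonempty (StructuredArrow (⟨x, c₀⟩ : DownSet p) (unit p)) := ⟨F s₀ hs₀⟩
    refine zigzag_isConnected fun t t' => ?_
    obtain ⟨s, hs, rfl⟩ := hF t
    obtain ⟨s', hs', rfl⟩ := hF t'
    exact hz s s' (Quotient.exact (hs.trans hs'.symm)) hs hs'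

end DownSet
end Reflection


/-! ### The comprehensive factorization system on `Cat` -/

/-- The arrow category `2`. -/
abbrev Two : Type u := AsSmall.{u} (Fin 2)

/-- The arrow of `2`. -/
def Two.arr : (AsSmall.up.obj 0 : Two.{u}) ⟶ AsSmall.up.obj 1 :=
  AsSmall.up.map (homOfLE (Fin.zero_le 1))

/-- The codomain functor `t : 1 ⥤ 2` of the arrow category. -/
def codFunctor : Discrete PUnit.{u + 1} ⥤ Two.{u} := Functor.fromPUnit (AsSmall.up.obj 1)

theorem final_codFunctor : codFunctor.{u}.Final :=
  Functor.final_fromPUnit_of_isTerminal (IsTerminal.ofUniqueHom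
    (fun x => AsSmall.up.map (X := AsSmall.down.obj x) (homOfLE (Fin.le_last _)))
    (fun _ _ => by apply ULift.ext; exact Subsingleton.elim _ _))

/-- The functor `2 ⥤ A` that corresponds to an arrow of `A`. -/
def ofArrow {A : Type u} [Category.{u} A] {a b : A} (k : a ⟶ b) : Two.{u} ⥤ A :=
  AsSmall.down ⋙ ComposableArrows.mk₁ k

theorem ofArrow_map {A : Type u} [Category.{u} A] {a b : A} (k : a ⟶ b) :
    (ofArrow k).map Two.arr = k := rfl

theorem two_ext {A : Type u} [Category.{u} A] {F G : Two.{u} ⥤ A}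
    (h0 : F.obj (AsSmall.up.obj 0) = G.obj (AsSmall.up.obj 0))
    (h1 : F.obj (AsSmall.up.obj 1) = G.obj (AsSmall.up.obj 1))
    (h : F.map Two.arr = eqToHom h0 ≫ G.map Two.arr ≫ eqToHom h1.symm) : F = G := by
  have : AsSmall.up ⋙ F = AsSmall.up ⋙ G := ComposableArrows.ext₁ h0 h1 h
  exact congrArg (fun H => AsSmall.down ⋙ H) this

theorem fromPUnit_ext {A : Type u} [Category.{u} A] {F G : Discrete PUnit.{u + 1} ⥤ A}
    (h : F.obj ⟨⟨⟩⟩ = G.obj ⟨⟨⟩⟩) : F = G :=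
  CategoryTheory.Functor.ext (fun _ => h) (by
    rintro ⟨⟨⟩⟩ ⟨⟨⟩⟩ f
    obtain rfl : f = 𝟙 _ := Subsingleton.elim _ _
    simp)

theorem isDiscreteFibration_of_orthogonal {A B : Type u} [Category.{u} A] [Category.{u} B]
    (n : A ⥤ B)
    (hn : ∀ (f : Discrete PUnit.{u + 1} ⥤ A) (g : Two.{u} ⥤ B), f ⋙ n = codFunctor ⋙ g →
      ∃! d : Two.{u} ⥤ A, codFunctor ⋙ d = f ∧ d ⋙ n = g) : IsDiscreteFibration n where
  lift b y h := by
    obtain ⟨d, ⟨h1, h2⟩, -⟩ := hn (Functor.fromPUnit b) (ofArrow h) (fromPUnit_ext rfl)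
    have hb : d.obj (AsSmall.up.obj 1) = b := Functor.congr_obj h1 ⟨⟨⟩⟩
    subst hb
    refine ⟨d.obj (AsSmall.up.obj 0), d.map Two.arr,
      Functor.congr_obj h2 (AsSmall.up.obj 0), ?_⟩
    refine (Functor.congr_hom h2 Two.arr).trans ?_
    rw [ofArrow_map]
    exact congrArg _ (Category.comp_id h)
  uniq {b a a'} k k' w hw := by
    obtain ⟨d, -, hd⟩ := hn (Functor.fromPUnit b) (ofArrow (n.map k')) (fromPUnit_ext rfl)
    have e1 := hd (ofArrow k) ⟨fromPUnit_ext rfl, two_ext w rfl (by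
      rw [Functor.comp_map, ofArrow_map, ofArrow_map]
      exact hw.trans (congrArg _ (Category.comp_id (n.map k')).symm))⟩
    have e2 := hd (ofArrow k') ⟨fromPUnit_ext rfl, two_ext rfl rfl (by
      rw [Functor.comp_map, ofArrow_map, ofArrow_map]
      exact ((Category.id_comp _).trans (Category.comp_id (n.map k'))).symm)⟩
    have e := e1.trans e2.symm
    refine ⟨Functor.congr_obj e (AsSmall.up.obj 0), ?_⟩
    have := Functor.congr_hom e Two.arr
    rw [ofArrow_map, ofArrow_map] at this
    exact this.trans (congrArg _ (Category.comp_id k'))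

/-- The terminal category `1`. -/
abbrev catOne : Cat.{u, u} := Cat.of (Discrete PUnit.{u + 1})

/-- The codomain `t : 1 ⟶ 2` of the arrow category. -/
def cod : catOne.{u} ⟶ Cat.of Two.{u} := codFunctor.toCatHom

/-- The class `M` of the functors orthogonal to `t`. -/
def discreteFibrations : MorphismProperty Cat.{u, u} := fun _ _ n => Orthogonal cod n

/-- The class `E` of the functors orthogonal to all the functors in `M`. -/
def finalFunctors : MorphismProperty Cat.{u, u} :=
  fun _ _ e => ∀ {A B : Cat.{u, u}} (m : A ⟶ B), discreteFibrations m → Orthogonal e m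

theorem orthogonal_of_final {P Q A B : Cat.{u, u}} (e : P ⟶ Q) (he : e.toFunctor.Final)
    (n : A ⟶ B) (hn : IsDiscreteFibration n.toFunctor) : Orthogonal e n := by
  intro f g w
  obtain ⟨d, ⟨h1, h2⟩, h3⟩ := hn.diagonal e.toFunctor f.toFunctor g.toFunctor
    (congrArg Cat.Hom.toFunctor w)
  exact ⟨⟨d⟩, ⟨Cat.ext h1, Cat.ext h2⟩, fun d' h => Cat.ext (h3 d'.toFunctor
    ⟨congrArg Cat.Hom.toFunctor h.1, congrArg Cat.Hom.toFunctor h.2⟩)⟩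

theorem discreteFibrations_iff {A B : Cat.{u, u}} (n : A ⟶ B) :
    discreteFibrations n ↔ IsDiscreteFibration n.toFunctor := by
  refine ⟨fun h => isDiscreteFibration_of_orthogonal _ fun f g w => ?_,
    orthogonal_of_final cod final_codFunctor n⟩
  obtain ⟨d, ⟨h1, h2⟩, h3⟩ := h ⟨f⟩ ⟨g⟩ (Cat.ext w)
  exact ⟨d.toFunctor, ⟨congrArg Cat.Hom.toFunctor h1, congrArg Cat.Hom.toFunctor h2⟩,
    fun d' h => congrArg Cat.Hom.toFunctor (h3 ⟨d'⟩ ⟨Cat.ext h.1, Cat.ext h.2⟩)⟩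

theorem finalFunctors_of_final {P Q : Cat.{u, u}} (e : P ⟶ Q) (he : e.toFunctor.Final) :
    finalFunctors e :=
  fun m hm => orthogonal_of_final e he m ((discreteFibrations_iff m).1 hm)

/-- Every functor factors as a functor in `E` followed by a functor in `M`. -/
instance hasFactorization_cat :
    MorphismProperty.HasFactorization finalFunctors.{u} discreteFibrations.{u} where
  nonempty_mapFactorizationData p := ⟨
    { Z := Cat.of (DownSet p.toFunctor)
      i := ⟨DownSet.unit p.toFunctor⟩
      p := ⟨DownSet.proj p.toFunctor⟩
      fac := rfl
      hi := finalFunctors_of_final _ (DownSet.final_unit _)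
      hp := (discreteFibrations_iff _).2 (DownSet.isDiscreteFibration_proj _) }⟩

/-- The class `E` is the class of the final functors. -/
theorem finalFunctors_iff {P Q : Cat.{u, u}} (e : P ⟶ Q) :
    finalFunctors e ↔ e.toFunctor.Final := by
  refine ⟨fun he => ?_, finalFunctors_of_final e⟩
  let i : P ⟶ Cat.of (DownSet e.toFunctor) := ⟨DownSet.unit e.toFunctor⟩
  let m : Cat.of (DownSet e.toFunctor) ⟶ Q := ⟨DownSet.proj e.toFunctor⟩
  have hm : discreteFibrations m :=
    (discreteFibrations_iff _).2 (DownSet.isDiscreteFibration_proj _)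
  have hi : i.toFunctor.Final := DownSet.final_unit _
  have him : i ≫ m = e := rfl
  obtain ⟨d, ⟨h1, h2⟩, -⟩ := he m hm i (𝟙 _) (by simp [him])
  have h3 : m ≫ d = 𝟙 _ := (finalFunctors_of_final i hi m hm i m rfl).unique
    ⟨by rw [← Category.assoc, him, h1], by rw [Category.assoc, h2, Category.comp_id]⟩
    ⟨Category.comp_id _, Category.id_comp _⟩
  have : m.toFunctor.IsEquivalence := (Cat.equivOfIso ⟨m, d, h3, h2⟩).isEquivalence_functor
  have : (i.toFunctor ⋙ m.toFunctor).Final := Functor.final_comp _ _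
  exact this

/-- The choices of a factorization `p = m e`, with `e` in `E` and `m` in `M`, of every functor. -/
abbrev CatFactorizations : Type (u + 1) :=
  ∀ ⦃P X : Cat.{u, u}⦄ (p : P ⟶ X),
    MorphismProperty.MapFactorizationData finalFunctors.{u} discreteFibrations.{u} p

instance : Nonempty CatFactorizations.{u} :=
  ⟨fun _ _ p => (hasFactorization_cat.nonempty_mapFactorizationData p).some⟩

/-- `Cat` with the comprehensive factorization system and a choice `D` of factorizations. -/
abbrev comprehensive (D : CatFactorizations.{u}) :
    EMCategory Cat.{u, u} where
  E := finalFunctors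
  M := discreteFibrations
  E_iff _ := Iff.rfl
  M_iff n := ⟨fun hn _ _ _ he => he n hn, fun h => h cod fun _ hm => hm⟩
  fac p := D p
  one := catOne
  isTerminalOne := Cat.isTerminalDiscretePUnit

/-! ### Cones and colimits in `Cat` -/

/-- The object of `X` that a point `1 ⟶ X` picks. -/
abbrev ptObj {X : Cat.{u, u}} (x : catOne ⟶ X) : X := x.toFunctor.obj ⟨⟨⟩⟩

/-- The slice category `X / x`, as a category over `X`. -/
def slice {X : Cat.{u, u}} (x : X) : Over X :=
  Over.mk (Y := Cat.of (Over x)) (Cat.Hom.ofFunctor (Over.forget x))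

/-- The identity of `x` as an object of `X / x`, over the point `x`. -/
def sliceId {X : Cat.{u, u}} (x : catOne ⟶ X) : Over.mk x ⟶ slice (ptObj x) :=
  Over.homMk (Cat.Hom.ofFunctor (Functor.fromPUnit (Over.mk (𝟙 (ptObj x)))))
    (Cat.ext (fromPUnit_ext rfl))

theorem isDiscreteFibration_forget {X : Type u} [Category.{u} X] (x : X) :
    IsDiscreteFibration (Over.forget x) where
  lift b _ h := ⟨Over.mk (h ≫ b.hom), Over.homMk h, rfl, (Category.id_comp h).symm⟩
  uniq {b a a'} k k' w hw := by
    obtain ⟨y, ⟨⟨⟩⟩, c⟩ := a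
    obtain ⟨y', ⟨⟨⟩⟩, c'⟩ := a'
    obtain rfl : y = y' := w
    have h : k.left = k'.left := by simpa using hw
    obtain rfl : c = c' := by
      have h1 := Over.w k
      have h2 := Over.w k'
      rw [h] at h1
      exact h1.symm.trans h2
    exact ⟨rfl, by ext; simpa using h⟩

section

variable (D : CatFactorizations.{u})

/-- The canonical isomorphism over `X` between the neighborhood of `x` and `X / x`, under the
point `x`. -/
def nbhdIsoSlice {X : Cat.{u, u}} (x : catOne ⟶ X) :
    (comprehensive D).nbhd x ≅ slice (ptObj x) :=
  (comprehensive D).downIso (sliceId x)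
    (finalFunctors_of_final _ (Functor.final_fromPUnit_of_isTerminal Over.mkIdTerminal))
    ((discreteFibrations_iff _).2 (isDiscreteFibration_forget _))

theorem lift_eq {P X : Type u} [Category.{u} P] [Category.{u} X] {p : P ⥤ X} {x : X}
    (F : P ⥤ Over x) (w : F ⋙ Over.forget x = p) :
    Over.lift p (X := x) (eqToHom w.symm ≫ Functor.whiskerLeft F (Over.forgetCocone x).ι) = F := by
  subst w
  refine CategoryTheory.Functor.ext (fun a => ?_) (fun a b k => ?_)
  · exact congrArg Over.mk (Category.id_comp (F.obj a).hom)
  · refine (Over.forget x).map_injective ?_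
    rw [Functor.map_comp, Functor.map_comp]
    erw [eqToHom_map, eqToHom_map]
    exact ((Category.id_comp _).trans (Category.comp_id (F.map k).left)).symm

/-- Functors to `X / x` over `X` are natural transformations to the constant functor `x`:
the functor `h` corresponds to the family of the arrows `h a : p a ⟶ x`. -/
def homSliceEquiv {P X : Cat.{u, u}} (p : P ⟶ X) (x : X) :
    (Over.mk p ⟶ slice x) ≃ (p.toFunctor ⟶ (Functor.const P).obj x) where
  toFun h := eqToHom (congrArg Cat.Hom.toFunctor (Over.w h)).symm ≫
    Functor.whiskerLeft h.left.toFunctor (Over.forgetCocone x).ι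
  invFun α := Over.homMk (Cat.Hom.ofFunctor (Over.lift p.toFunctor α)) rfl
  left_inv h := by
    ext : 1
    exact Cat.ext (lift_eq h.left.toFunctor (congrArg Cat.Hom.toFunctor (Over.w h)))
  right_inv α := by
    ext a
    exact Category.id_comp _

/-- The cones `p ⟶ ν(x)` over `X` are the usual cones with base `p` and vertex `x`. -/
def coneEquiv {P X : Cat.{u, u}} (p : P ⟶ X) (x : catOne ⟶ X) :
    (comprehensive D).Cone (Over.mk p) x ≃ (p.toFunctor ⟶ (Functor.const P).obj (ptObj x)) :=
  ((nbhdIsoSlice D x).homToEquiv).trans (homSliceEquiv p (ptObj x))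

/-- The usual cone under `p` (in Mathlib: a cocone) that corresponds to a cone `p ⟶ ν(x)`. -/
def toCocone {P X : Cat.{u, u}} {p : P ⟶ X} {x : catOne ⟶ X}
    (c : (comprehensive D).Cone (Over.mk p) x) : Cocone p.toFunctor where
  pt := ptObj x
  ι := coneEquiv D p x c

/-- The classical image `a ↦ f (c a)` of a cone along a functor `f`, as a cone in the sense of
the factorization system. -/
def classicalImage {P X Y : Cat.{u, u}} {p : P ⟶ X} {x : catOne ⟶ X} (f : X ⟶ Y)
    (c : (comprehensive D).Cone (Over.mk p) x) :
    (comprehensive D).Cone (Over.mk (p ≫ f)) (x ≫ f) :=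
  (coneEquiv D (p ≫ f) (x ≫ f)).symm (f.toFunctor.mapCocone (toCocone D c)).ι

end

end EMTheory

end

/-!
As the neighborhoods `ν(x)` are discrete, a cone is determined by its restriction along any map
of `E`, and every cone extends along such a map. So being colimiting is invariant under
restriction along maps of `E` (`isColimiting_comp_iff`); in particular a cone and its kernel are
colimiting together.

The restriction of the direct image of a cone `c : m ⟶ ν(x)` along `f ∘ m ⟶ ∃_f m` is `c`
followed by the map `f ∘ ν(x) ⟶ ν(f x)` (`unit_imageCone`). In `Cat`, under the isomorphisms
`ν(x) ≅ X / x`, the latter is the functor `X / x ⥤ Y / f x` induced by `f`, because both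
send the identity of `x` to the identity of `f x` and the inclusion of `x` in `X / x` is final
(`map_nbhdIsoSlice_comp_sliceMap`). Hence that restriction is the classical image of `c`
(`unit_imageCone_eq_classicalImage`), whatever the base is.

Finally, maps `ν(x) ⟶ ν(y)` over `X` are maps `X / x ⥤ X / y` over `X`, which by the Yoneda lemma
are arrows `x ⟶ y`, and composition with them is composition with the arrows (`coneEquiv_comp`).
So colimiting cones are the usual colimits (`isColimiting_iff`), and `f` preserves a cone if and
only if its classical image is a colimit (`preservesCone_iff`). Since the classical notion of
preservation concerns arbitrary bases, a diagram is replaced by its discrete reflection, whose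
cones are the kernels of the cones of the diagram.
-/

namespace EMTheory

/-! ### Restriction of cones along final maps -/

theorem orthogonal_of_isIso {C : Type u} [Category.{v} C] {A X B Y : C} (e : A ⟶ X) [IsIso e]
    (m : B ⟶ Y) : Orthogonal e m := fun f g w =>
  ⟨inv e ≫ f, ⟨by simp, by simp [w]⟩, fun d h => by simp [← h.1]⟩

namespace EMCategory

variable {C : Type u} [Category.{v} C] [HasFiniteLimits C] (S : EMCategory C)

theorem E_left_of_iso {X : C} {p q : Over X} (i : p ≅ q) : S.E i.hom.left :=
  (S.E_iff _).2 fun m _ =>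
    have : IsIso i.hom.left := inferInstanceAs (IsIso ((Over.forget X).map i.hom))
    orthogonal_of_isIso _ m

theorem unit_desc {X : C} {p n : Over X} (hn : S.IsDiscrete n) (g : p ⟶ n) :
    S.unit p ≫ S.desc hn g = g :=
  S.extend_fac _ _ _ _

theorem unit_kernel {X : C} {p : Over X} {x : S.one ⟶ X} (c : S.Cone p x) :
    S.unit p ≫ S.kernel c = c :=
  S.unit_desc _ _

theorem E_comp {X Y Z : C} {e : X ⟶ Y} {e' : Y ⟶ Z} (h : S.E e) (h' : S.E e') : S.E (e ≫ e') :=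
  (S.E_iff _).2 fun m hm => ((S.E_iff _).1 h m hm).comp ((S.E_iff _).1 h' m hm)

theorem E_map_unit_unit {X Y : C} (f : X ⟶ Y) (p : Over X) :
    S.E ((Over.map f).map (S.unit p) ≫ S.unit ((Over.map f).obj (S.down p))).left :=
  S.E_comp (S.E_unit p) (S.E_unit _)

theorem map_unit_unit_directImageDownIso_hom {X Y : C} (f : X ⟶ Y) (p : Over X) :
    (Over.map f).map (S.unit p) ≫ S.unit ((Over.map f).obj (S.down p)) ≫
      (S.directImageDownIso f p).hom = S.unit ((Over.map f).obj p) := by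
  rw [← Category.assoc]
  exact S.extend_fac _ (S.E_map_unit_unit f p) (S.isDiscrete_down _) _

theorem unit_imageCone {X Y : C} (f : X ⟶ Y) {m : Over X} {x : S.one ⟶ X} (c : S.Cone m x) :
    S.unit ((Over.map f).obj m) ≫ S.imageCone f c =
      (Over.map f).map c ≫ S.unit _ ≫ (S.directImageNbhdIso f x).hom := by
  rw [imageCone, ← Category.assoc, directImageMap, downMap, unit_desc, Category.assoc]

/-- If a cone `d` is `c` followed by the canonical map `f ∘ ν(x) ⟶ ν(f x)`, then the kernel of `d`
is the direct image of the kernel of `c`, as both have the same restriction to `f ∘ p`. -/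
theorem directImageDownIso_hom_kernel_of_eq {X Y : C} (f : X ⟶ Y) {p : Over X} {x : S.one ⟶ X}
    (c : S.Cone p x) (d : S.Cone ((Over.map f).obj p) (x ≫ f))
    (h : (Over.map f).map c ≫ S.unit _ ≫ (S.directImageNbhdIso f x).hom = d) :
    (S.directImageDownIso f p).hom ≫ S.kernel d = S.imageCone f (S.kernel c) := by
  refine S.extend_hom_ext _ (S.E_map_unit_unit f p) (S.isDiscrete_nbhd _) ?_
  rw [Category.assoc, Category.assoc, unit_imageCone, ← Functor.map_comp_assoc, unit_kernel, h,
    ← Category.assoc (S.unit _), ← Category.assoc, map_unit_unit_directImageDownIso_hom,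
    unit_kernel]

/-- Restriction along a map of `E` does not change whether a cone is colimiting. -/
theorem isColimiting_comp_iff {X : C} {p q : Over X} (e : p ⟶ q) (he : S.E e.left)
    {x : S.one ⟶ X} (c : S.Cone q x) : S.IsColimiting (p := p) (e ≫ c) ↔ S.IsColimiting c := by
  refine ⟨fun h y d => ?_, fun h y d => ?_⟩
  · obtain ⟨k, hk, hu⟩ := h y (e ≫ d)
    refine ⟨k, S.extend_hom_ext e he (S.isDiscrete_nbhd y) (by simpa using hk), fun k' hk' => ?_⟩
    exact hu k' (by simp [← hk'])
  · obtain ⟨k, hk, hu⟩ := h y (S.extend e he (S.isDiscrete_nbhd y) d)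
    have hd := S.extend_fac e he (S.isDiscrete_nbhd y) d
    refine ⟨k, by simp only [Category.assoc, hk, hd], fun k' hk' => hu k' ?_⟩
    exact S.extend_hom_ext e he (S.isDiscrete_nbhd y) (by
      rw [hd, ← hk', Category.assoc])

theorem isColimiting_kernel_iff {X : C} {p : Over X} {x : S.one ⟶ X} (c : S.Cone p x) :
    S.IsColimiting (S.kernel c) ↔ S.IsColimiting c := by
  rw [← S.isColimiting_comp_iff (S.unit p) (S.E_unit p), unit_kernel]

end EMCategory

open EMCategory

/-! ### The functors between slices induced by a functor -/

/-- The functor `X / x ⥤ Y / f x` induced by `f`, as a map over `Y`. -/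
def sliceMap {X Y : Cat.{u, u}} (f : X ⟶ Y) (x : X) :
    (Over.map f).obj (slice x) ⟶ slice (f.toFunctor.obj x) :=
  Over.homMk (Cat.Hom.ofFunctor (Over.post f.toFunctor)) rfl

theorem map_sliceId_comp_sliceMap {X Y : Cat.{u, u}} (f : X ⟶ Y) (x : catOne ⟶ X) :
    (Over.map f).map (sliceId x) ≫ sliceMap f (ptObj x) = sliceId (x ≫ f) := by
  ext : 1
  refine Cat.ext (fromPUnit_ext ?_)
  exact congrArg Over.mk (f.toFunctor.map_id (ptObj x))

/-- The component at `a` of the cone given by `h : P ⥤ X / x` is the structure map of the object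
`h a` of `X / x`, up to the equality between `p a` and the domain of `h a`. -/
theorem homSliceEquiv_apply_app {P X : Cat.{u, u}} (p : P ⟶ X) (x : X)
    (h : Over.mk p ⟶ slice x) (a : P) :
    (homSliceEquiv p x h).app a =
      eqToHom (Functor.congr_obj (congrArg Cat.Hom.toFunctor (Over.w h)) a).symm ≫
        (h.left.toFunctor.obj a).hom :=
  congrArg (· ≫ (h.left.toFunctor.obj a).hom) (eqToHom_app _ _)

theorem homSliceEquiv_comp {P X Q : Cat.{u, u}} (p : P ⟶ X) (q : Q ⟶ X) (x : X)
    (g : Over.mk p ⟶ Over.mk q) (h : Over.mk q ⟶ slice x) (a : P) :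
    (homSliceEquiv p x (g ≫ h)).app a =
      eqToHom (Functor.congr_obj (congrArg Cat.Hom.toFunctor (Over.w g)) a).symm ≫
        (homSliceEquiv q x h).app (g.left.toFunctor.obj a) := by
  rw [homSliceEquiv_apply_app, homSliceEquiv_apply_app]
  erw [eqToHom_trans_assoc]
  rfl

theorem homSliceEquiv_map {P X Y : Cat.{u, u}} (p : P ⟶ X) (f : X ⟶ Y) (x : X)
    (h : Over.mk p ⟶ slice x) (a : P) :
    (homSliceEquiv (p ≫ f) (f.toFunctor.obj x) ((Over.map f).map h ≫ sliceMap f x)).app a =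
      f.toFunctor.map ((homSliceEquiv p x h).app a) := by
  refine (homSliceEquiv_apply_app _ _ _ a).trans ?_
  rw [homSliceEquiv_apply_app]
  refine Eq.trans ?_ (f.toFunctor.map_comp _ _).symm
  exact congrArg (· ≫ f.toFunctor.map (h.left.toFunctor.obj a).hom)
    (eqToHom_map f.toFunctor _).symm

section

variable (D : CatFactorizations.{u})

theorem isDiscrete_slice {X : Cat.{u, u}} (x : X) : (comprehensive D).IsDiscrete (slice x) :=
  (discreteFibrations_iff _).2 (isDiscreteFibration_forget _)

theorem unit_nbhdIsoSlice_hom {X : Cat.{u, u}} (x : catOne ⟶ X) :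
    (comprehensive D).unit (Over.mk x) ≫ (nbhdIsoSlice D x).hom = sliceId x :=
  (comprehensive D).unit_desc (isDiscrete_slice D _) _

/-- The canonical map `f ∘ ν(x) ⟶ ν(f x)` is the functor `X / x ⥤ Y / f x` induced by `f`. -/
theorem map_nbhdIsoSlice_comp_sliceMap {X Y : Cat.{u, u}} (f : X ⟶ Y) (x : catOne ⟶ X) :
    (Over.map f).map (nbhdIsoSlice D x).hom ≫ sliceMap f (ptObj x) =
      ((comprehensive D).unit _ ≫ ((comprehensive D).directImageNbhdIso f x).hom) ≫
        (nbhdIsoSlice D (x ≫ f)).hom := by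
  -- the point `x ⟶ ν(x)` is in `E`, so it suffices to compare the images of the point
  refine (comprehensive D).extend_hom_ext
    ((Over.map f).map ((comprehensive D).unit (Over.mk x)))
    ((comprehensive D).E_unit (Over.mk x)) (isDiscrete_slice D _) ?_
  rw [← Category.assoc, ← Functor.map_comp, unit_nbhdIsoSlice_hom]
  refine (map_sliceId_comp_sliceMap f x).trans ?_
  rw [← Category.assoc, directImageNbhdIso, map_unit_unit_directImageDownIso_hom]
  exact (unit_nbhdIsoSlice_hom D (x ≫ f)).symm

/-- The direct image of a cone, restricted to `f ∘ p`, is the classical image. -/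
theorem unit_imageCone_eq_classicalImage {P X Y : Cat.{u, u}} {p : P ⟶ X} {x : catOne ⟶ X}
    (f : X ⟶ Y) (c : (comprehensive D).Cone (Over.mk p) x) :
    (Over.map f).map c ≫ (comprehensive D).unit _ ≫
        ((comprehensive D).directImageNbhdIso f x).hom =
      classicalImage D f c := by
  refine (coneEquiv D (p ≫ f) (x ≫ f)).injective ?_
  refine Eq.trans ?_ ((coneEquiv D (p ≫ f) (x ≫ f)).apply_symm_apply _).symm
  change homSliceEquiv _ _ (((Over.map f).map c ≫ _) ≫ (nbhdIsoSlice D (x ≫ f)).hom) = _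
  rw [Category.assoc, ← map_nbhdIsoSlice_comp_sliceMap, ← Category.assoc, ← Functor.map_comp]
  ext a
  exact homSliceEquiv_map p f (ptObj x) (c ≫ (nbhdIsoSlice D x).hom) a

/-! ### Colimiting cones in `Cat` -/

/-- The maps `ν(x) ⟶ ν(y)` over `X` are the arrows `x ⟶ y`, by the Yoneda lemma. -/
noncomputable def nbhdHomEquiv {X : Cat.{u, u}} (x y : catOne ⟶ X) :
    ((comprehensive D).nbhd x ⟶ (comprehensive D).nbhd y) ≃ (ptObj x ⟶ ptObj y) where
  toFun k := (coneEquiv D x y ((comprehensive D).unit _ ≫ k)).app ⟨⟨⟩⟩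
  invFun k := (comprehensive D).desc ((comprehensive D).isDiscrete_nbhd y)
    ((coneEquiv D x y).symm (Discrete.natTrans fun _ => k))
  left_inv k := by
    refine (comprehensive D).extend_hom_ext _ ((comprehensive D).E_unit (Over.mk x))
      ((comprehensive D).isDiscrete_nbhd y) ?_
    rw [unit_desc]
    refine (coneEquiv D x y).symm_apply_eq.2 ?_
    ext ⟨⟨⟩⟩
    rfl
  right_inv k := by
    refine Eq.trans (congrArg (fun d => (coneEquiv D x y d).app ⟨⟨⟩⟩)
      ((comprehensive D).unit_desc ((comprehensive D).isDiscrete_nbhd y) _)) ?_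
    exact congrArg (fun α => α.app ⟨⟨⟩⟩) ((coneEquiv D x y).apply_symm_apply _)

/-- On cones, composition with a map `X / x ⥤ X / y` over `X` is composition with the arrow `x ⟶ y`
that is the image of the identity of `x`. -/
theorem homSliceEquiv_comp_slice {P X : Cat.{u, u}} (p : P ⟶ X) (x y : X)
    (h : Over.mk p ⟶ slice x) (k : slice x ⟶ slice y) (a : P) :
    (homSliceEquiv p y (h ≫ k)).app a = (homSliceEquiv p x h).app a ≫
      (homSliceEquiv _ y k).app (Over.mk (𝟙 x)) := by
  refine (homSliceEquiv_comp (Q := Cat.of (Over x)) p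
    (Cat.Hom.ofFunctor (Over.forget x)) y h k a).trans ?_
  -- naturality of `k` at the unique arrow from an object of `X / x` to the terminal one
  have := (homSliceEquiv (P := Cat.of (Over x)) (Cat.Hom.ofFunctor (Over.forget x)) y k).naturality
    (Over.homMk (h.left.toFunctor.obj a).hom : h.left.toFunctor.obj a ⟶ Over.mk (𝟙 x))
  rw [homSliceEquiv_apply_app p x]
  refine Eq.trans ?_ (Category.assoc _ _ _).symm
  exact congrArg (_ ≫ ·) ((Category.comp_id _).symm.trans this.symm)

/-- Composition with a map `ν(x) ⟶ ν(y)` is composition of cones with the arrow `x ⟶ y`. -/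
theorem coneEquiv_comp {P X : Cat.{u, u}} {p : P ⟶ X} {x y : catOne ⟶ X}
    (c : (comprehensive D).Cone (Over.mk p) x)
    (k : (comprehensive D).nbhd x ⟶ (comprehensive D).nbhd y) (a : P) :
    (coneEquiv D p y (c ≫ k)).app a = (coneEquiv D p x c).app a ≫ nbhdHomEquiv D x y k := by
  -- transport along `ν(x) ≅ X / x` and `ν(y) ≅ X / y`
  obtain ⟨l, rfl⟩ : ∃ l, k = (nbhdIsoSlice D x).hom ≫ l ≫ (nbhdIsoSlice D y).inv :=
    ⟨(nbhdIsoSlice D x).inv ≫ k ≫ (nbhdIsoSlice D y).hom, by simp⟩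
  have key : ∀ {Q : Cat.{u, u}} {q : Q ⟶ X} (d : (comprehensive D).Cone (Over.mk q) x),
      coneEquiv D q y (d ≫ (nbhdIsoSlice D x).hom ≫ l ≫ (nbhdIsoSlice D y).inv) =
        homSliceEquiv q (ptObj y) ((d ≫ (nbhdIsoSlice D x).hom) ≫ l) := fun d => by
    change homSliceEquiv _ _ ((d ≫ (nbhdIsoSlice D x).hom ≫ l ≫ (nbhdIsoSlice D y).inv) ≫
      (nbhdIsoSlice D y).hom) = _
    simp
  have h1 : nbhdHomEquiv D x y ((nbhdIsoSlice D x).hom ≫ l ≫ (nbhdIsoSlice D y).inv) =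
      (homSliceEquiv _ (ptObj y) l).app (Over.mk (𝟙 (ptObj x))) := by
    change (coneEquiv D x y _).app _ = _
    rw [key, unit_nbhdIsoSlice_hom]
    refine (homSliceEquiv_comp_slice x _ _ (sliceId x) l ⟨⟨⟩⟩).trans ?_
    refine (congrArg (· ≫ _) (homSliceEquiv_apply_app x _ (sliceId x) ⟨⟨⟩⟩)).trans ?_
    exact (congrArg (· ≫ _) (Category.id_comp _)).trans (Category.id_comp _)
  rw [key, h1]
  exact homSliceEquiv_comp_slice _ _ _ _ _ _

/-- The colimiting cones are the usual ones. -/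
theorem isColimiting_iff {P X : Cat.{u, u}} {p : P ⟶ X} {x : catOne ⟶ X}
    (c : (comprehensive D).Cone (Over.mk p) x) :
    (comprehensive D).IsColimiting c ↔ Nonempty (IsColimit (toCocone D c)) := by
  have key : ∀ (y : catOne ⟶ X) (d : (comprehensive D).Cone (Over.mk p) y)
      (k : (comprehensive D).nbhd x ⟶ (comprehensive D).nbhd y),
      c ≫ k = d ↔ ∀ a, (coneEquiv D p x c).app a ≫ nbhdHomEquiv D x y k =
        (coneEquiv D p y d).app a := fun y d k => by
    rw [← (coneEquiv D p y).injective.eq_iff, NatTrans.ext_iff, funext_iff]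
    exact forall_congr' fun a => by rw [coneEquiv_comp]
  refine ⟨fun h => ⟨IsColimit.ofExistsUnique fun s => ?_⟩, fun ⟨h⟩ y d => ?_⟩
  · let y : catOne ⟶ X := Cat.Hom.ofFunctor (Functor.fromPUnit s.pt)
    let d : (comprehensive D).Cone (Over.mk p) y := (coneEquiv D p y).symm s.ι
    have hd : coneEquiv D p y d = s.ι := Equiv.apply_symm_apply _ _
    obtain ⟨k, hk, hu⟩ := h y d
    refine ⟨nbhdHomEquiv D x y k, fun a => ?_, fun l hl => ?_⟩
    · exact ((key y d k).1 hk a).trans (by rw [hd])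
    · rw [← hu ((nbhdHomEquiv D x y).symm l) ((key y d _).2 fun a => by
        rw [hd]
        exact (congrArg (_ ≫ ·) ((nbhdHomEquiv D x y).apply_symm_apply l)).trans (hl a))]
      exact (Equiv.apply_symm_apply (nbhdHomEquiv D x y) l).symm
  · refine ⟨(nbhdHomEquiv D x y).symm (h.desc (toCocone D d)), (key y d _).2 fun a => ?_,
      fun k hk => ?_⟩
    · exact (congrArg (_ ≫ ·) ((nbhdHomEquiv D x y).apply_symm_apply _)).trans
        (h.fac (toCocone D d) a)
    · refine (nbhdHomEquiv D x y).eq_symm_apply.2 ?_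
      exact h.uniq (toCocone D d) _ ((key y d k).1 hk)

theorem isColimiting_classicalImage_iff {P X Y : Cat.{u, u}} {p : P ⟶ X} {x : catOne ⟶ X}
    (f : X ⟶ Y) (c : (comprehensive D).Cone (Over.mk p) x) :
    (comprehensive D).IsColimiting (classicalImage D f c) ↔
      Nonempty (IsColimit (f.toFunctor.mapCocone (toCocone D c))) := by
  have : toCocone D (classicalImage D f c) = f.toFunctor.mapCocone (toCocone D c) :=
    congrArg (Cocone.mk (F := (p ≫ f).toFunctor) (ptObj (x ≫ f)))
      ((coneEquiv D (p ≫ f) (x ≫ f)).apply_symm_apply _)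
  rw [isColimiting_iff, this]

/-- The base need not be discrete: the direct image of `c` restricts, along the map
`f ∘ p ⟶ ↓ (f ∘ p)` of `E`, to the classical image. -/
theorem preservesCone_iff {P X Y : Cat.{u, u}} {p : P ⟶ X} {x : catOne ⟶ X}
    (f : X ⟶ Y) (c : (comprehensive D).Cone (Over.mk p) x) :
    (comprehensive D).PreservesCone f c ↔
      Nonempty (IsColimit (f.toFunctor.mapCocone (toCocone D c))) := by
  rw [← isColimiting_classicalImage_iff, ← unit_imageCone_eq_classicalImage, PreservesCone,
    ← unit_imageCone]
  exact ((comprehensive D).isColimiting_comp_iff _ ((comprehensive D).E_unit _) _).symm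

/-- The direct image of the kernel cone is the kernel cone of the classical image. -/
theorem directImageDownIso_hom_kernel {P X Y : Cat.{u, u}} {p : P ⟶ X} {x : catOne ⟶ X}
    (f : X ⟶ Y) (c : (comprehensive D).Cone (Over.mk p) x) :
    ((comprehensive D).directImageDownIso f (Over.mk p)).hom ≫
        (comprehensive D).kernel (classicalImage D f c) =
      (comprehensive D).imageCone f ((comprehensive D).kernel c) := by
  refine ((comprehensive D).directImageDownIso_hom_kernel_of_eq f c _ ?_)
  exact unit_imageCone_eq_classicalImage D f c

theorem preservesCone_kernel_iff {P X Y : Cat.{u, u}} {p : P ⟶ X} {x : catOne ⟶ X}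
    (f : X ⟶ Y) (c : (comprehensive D).Cone (Over.mk p) x) :
    (comprehensive D).PreservesCone f ((comprehensive D).kernel c) ↔
      Nonempty (IsColimit (f.toFunctor.mapCocone (toCocone D c))) := by
  rw [← isColimiting_classicalImage_iff, PreservesCone, ← directImageDownIso_hom_kernel,
    ← (comprehensive D).isColimiting_kernel_iff (classicalImage D f c)]
  -- an isomorphism over `Y` is in `E`
  refine (comprehensive D).isColimiting_comp_iff _ ?_ _
  exact (comprehensive D).E_left_of_iso _

/-- A functor that preserves the colimiting cones with a discrete base preserves the colimit of a
diagram `K`, because it preserves the kernel of the colimit cone, whose base is discrete. -/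
theorem colimitPreserving_iff {X Y : Cat.{u, u}} (f : X ⟶ Y) :
    (comprehensive D).ColimitPreserving f ↔ PreservesColimitsOfSize.{u, u} f.toFunctor := by
  refine ⟨fun h => ⟨fun {J} _ => ⟨fun {K} => ⟨fun {s} hs => ?_⟩⟩⟩, fun h m _ x c hc => ?_⟩
  · let p : Cat.of J ⟶ X := Cat.Hom.ofFunctor K
    let x : catOne ⟶ X := Cat.Hom.ofFunctor (Functor.fromPUnit s.pt)
    let c : (comprehensive D).Cone (Over.mk p) x := (coneEquiv D p x).symm s.ι
    have hc : toCocone D c = s :=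
      congrArg (Cocone.mk (F := K) s.pt) ((coneEquiv D p x).apply_symm_apply s.ι)
    have := (preservesCone_kernel_iff D f c).1 (h _ ((comprehensive D).isDiscrete_down _) x _
      (((comprehensive D).isColimiting_kernel_iff c).2
        ((isColimiting_iff D c).2 (hc.symm ▸ ⟨hs⟩))))
    rwa [hc] at this
  · obtain ⟨hc⟩ := (isColimiting_iff D (p := m.hom) c).1 hc
    exact (preservesCone_iff D (p := m.hom) f c).2 ⟨isColimitOfPreserves f.toFunctor hc⟩

end

end EMTheory

theorem mainTheorem11 (D : EMTheory.CatFactorizations.{u}) :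
    (∀ {P X Y : Cat.{u, u}} (p : P ⟶ X) (f : X ⟶ Y) (x : EMTheory.catOne ⟶ X)
      (c : (EMTheory.comprehensive D).Cone (Over.mk p) x),
      ((EMTheory.comprehensive D).directImageDownIso f (Over.mk p)).hom ≫
          (EMTheory.comprehensive D).kernel (EMTheory.classicalImage D f c) =
        (EMTheory.comprehensive D).imageCone f ((EMTheory.comprehensive D).kernel c)) ∧
    (∀ {P X Y : Cat.{u, u}} (p : P ⟶ X) (f : X ⟶ Y) (x : EMTheory.catOne ⟶ X)
      (c : (EMTheory.comprehensive D).Cone (Over.mk p) x),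
      Nonempty (IsColimit (EMTheory.toCocone D c)) →
        (EMTheory.comprehensive D).IsColimiting ((EMTheory.comprehensive D).kernel c) ∧
        (Nonempty (IsColimit (f.toFunctor.mapCocone (EMTheory.toCocone D c))) ↔
          (EMTheory.comprehensive D).PreservesCone f ((EMTheory.comprehensive D).kernel c))) ∧
    (∀ {X Y : Cat.{u, u}} (f : X ⟶ Y),
      (EMTheory.comprehensive D).ColimitPreserving f ↔
        PreservesColimitsOfSize.{u, u} f.toFunctor) :=
  ⟨fun _ f _ c => EMTheory.directImageDownIso_hom_kernel D f c,
    fun _ f _ c hc =>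
      ⟨((EMTheory.comprehensive D).isColimiting_kernel_iff c).2
        ((EMTheory.isColimiting_iff D c).2 hc), (EMTheory.preservesCone_kernel_iff D f c).symm⟩,
    EMTheory.colimitPreserving_iff D⟩
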